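/- A data set $(\mathfrak g,\mathfrak v,\pi)$ consists of a finite-dimensional real Lie algebra $\mathfrak g$ with an $\mathrm{ad}$-invariant metric $\langle\cdot,\cdot\rangle_{\mathfrak g}$, a finite-dimensional real vector space $\mathfrak v$ with a metric $\langle\cdot,\cdot\rangle_{\mathfrak v}$ (here a metric is a nondegenerate symmetric bilinear form of arbitrary signature), and a faithful real representation $\pi:\mathfrak g\to\mathfrak{so}(\mathfrak v,\langle\cdot,\cdot\rangle_{\mathfrak v})$ without trivial subrepresentations, i.e. $\bigcap_{Z\in\mathfrak g}\ker\pi(Z)=\{0\}$. A metric is Riemannian if it is positive definite and Lorentzian if it has signature one, i.e. if the maximal dimension of a negative definite subspace is one. The data set is called Lorentzian if the metric on $\mathfrak g\oplus\mathfrak v$ which restricts to the given metrics on $\mathfrak g$ and $\mathfrak v$ and makes $\mathfrak g$ and $\mathfrak v$ orthogonal is Lorentzian. A nonzero vector $w$ is lightlike if $\langle w,w\rangle_{\mathfrak v}=0$. Theorem. Let $(\mathfrak g,\mathfrak v,\pi)$ be a Lorentzian data set such that $\langle\cdot,\cdot\rangle_{\mathfrak v}$ is Lorentzian, and let $\mathfrak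 c$ be the center of $\mathfrak g$. Then there are $k\ge 0$ and an orthogonal direct sum decomposition $$\mathfrak v=\mathfrak v_0\oplus\mathfrak v_1\oplus\cdots\oplus\mathfrak v_k$$ into $\pi(\mathfrak g)$-invariant subspaces such that the following hold. 1. For every $i\ge 1$ the subspace $\mathfrak v_i$ is Riemannian and $\pi(\mathfrak g)$-irreducible. The subspace $\mathfrak v_0$ is Lorentzian of dimension $2$ and is the direct sum of two $\pi(\mathfrak g)$-invariant (hence irreducible) lines, each spanned by a lightlike vector. 2. For every $i=1,\dots,k$, either there is a skew-symmetric map $J_i:\mathfrak v_i\to\mathfrak v_i$ with $J_i^2=-\mathrm{Id}$ such that for every $Z\in\mathfrak c$ one has $\pi(Z)|_{\mathfrak v_i}=\lambda_i(Z)J_i$ for some $\lambda_i(Z)\in\mathbb R$, or $\dim\mathfrak v_i$ is odd and $\pi(Z)|_{\mathfrak v_i}=0$ for every $Z\in\mathfrak c$. In particular such a $J_i$ exists whenever $\mathfrak c$ acts non-trivially on $\mathfrak v_i$. 3. There is a map $J_0\in\mathfrak{so}(\mathfrak v_0)$ with $J_0^2=\mathrm{Id}$ such that for every $Z\in\mathfrak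 c$ one has $\pi(Z)|_{\mathfrak v_0}=\lambda_0(Z)J_0$ for some $\lambda_0(Z)\in\mathbb R$. -/

import Mathlib

-- The bracket of an associative ring is the commutator.
attribute [local instance 100] LieRing.ofAssociativeRing

/-- The Lie algebra `𝔰𝔬(V, B)` of endomorphisms `A` of `V` that are skew-symmetric for `B`, that is,
`B (A x) y = -B x (A y)` for all `x` and `y`. -/
abbrev soAlg {V : Type*} [AddCommGroup V] [Module ℝ V] (B : LinearMap.BilinForm ℝ V) :
    LieSubalgebra ℝ (Module.End ℝ V) :=
  skewAdjointLieSubalgebra B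

/-- A metric on a real vector space: a nondegenerate symmetric bilinear form, of any signature. -/
structure IsMetric {V : Type*} [AddCommGroup V] [Module ℝ V] (B : LinearMap.BilinForm ℝ V) :
    Prop where
  symm : B.IsSymm
  nondegenerate : B.Nondegenerate

/-- A Riemannian metric: a symmetric positive definite bilinear form. -/
structure IsRiemannian {V : Type*} [AddCommGroup V] [Module ℝ V] (B : LinearMap.BilinForm ℝ V) :
    Prop where
  symm : B.IsSymm
  pos : ∀ x, x ≠ 0 → 0 < B x x

/-- A Lorentzian metric: a nondegenerate symmetric bilinear form of signature one, i.e. the maximal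
dimension of a subspace on which it is negative definite is one. -/
structure IsLorentzian {V : Type*} [AddCommGroup V] [Module ℝ V] (B : LinearMap.BilinForm ℝ V) :
    Prop extends IsMetric B where
  sigNeg_eq_one : sigNeg B.toQuadraticMap = 1

/-- A vector is lightlike if it is nonzero and orthogonal to itself. -/
def IsLightlike {V : Type*} [AddCommGroup V] [Module ℝ V] (B : LinearMap.BilinForm ℝ V) (w : V) :
    Prop :=
  w ≠ 0 ∧ B w w = 0

/-- A data set `(𝔤, 𝔳, π)`. -/
structure DataSet (𝔤 𝔳 : Type*) [LieRing 𝔤] [LieAlgebra ℝ 𝔤] [AddCommGroup 𝔳] [Module ℝ 𝔳] where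
  /-- the metric on `𝔤` -/
  metricG : LinearMap.BilinForm ℝ 𝔤
  isMetric_metricG : IsMetric metricG
  /-- the metric on `𝔤` is ad-invariant -/
  ad_mem_so : ∀ Z : 𝔤, LieAlgebra.ad ℝ 𝔤 Z ∈ soAlg metricG
  /-- the metric on `𝔳` -/
  metricV : LinearMap.BilinForm ℝ 𝔳
  isMetric_metricV : IsMetric metricV
  /-- the representation of `𝔤` on `𝔳` -/
  π : 𝔤 →ₗ⁅ℝ⁆ Module.End ℝ 𝔳
  /-- the representation is faithful -/
  faithful : Function.Injective π
  /-- the representation has no trivial subrepresentations -/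
  iInf_ker_eq_bot : ⨅ Z : 𝔤, LinearMap.ker (π Z) = ⊥
  /-- the metric on `𝔳` is `π(𝔤)`-invariant -/
  π_mem_so : ∀ Z : 𝔤, π Z ∈ soAlg metricV

namespace DataSet

variable {𝔤 𝔳 : Type*} [LieRing 𝔤] [LieAlgebra ℝ 𝔤] [AddCommGroup 𝔳] [Module ℝ 𝔳]

/-- The metric on `𝔫 = 𝔤 ⊕ 𝔳` that restricts to the given metrics on `𝔤` and `𝔳` and makes these two
subspaces orthogonal to each other. -/
def metricN (D : DataSet 𝔤 𝔳) : LinearMap.BilinForm ℝ (𝔤 × 𝔳) :=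
  D.metricG.compl₁₂ (LinearMap.fst ℝ 𝔤 𝔳) (LinearMap.fst ℝ 𝔤 𝔳) +
    D.metricV.compl₁₂ (LinearMap.snd ℝ 𝔤 𝔳) (LinearMap.snd ℝ 𝔤 𝔳)

theorem metricN_apply (D : DataSet 𝔤 𝔳) (p q : 𝔤 × 𝔳) :
    D.metricN p q = D.metricG p.1 q.1 + D.metricV p.2 q.2 := rfl

/-- A Lorentzian data set: the metric on `𝔫 = 𝔤 ⊕ 𝔳` has signature one. -/
def IsLorentzianDataSet (D : DataSet 𝔤 𝔳) : Prop :=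
  IsLorentzian D.metricN

/-- `W` is a `π(𝔤)`-invariant subspace of `𝔳`. -/
def IsInvariantSubspace (D : DataSet 𝔤 𝔳) (W : Submodule ℝ 𝔳) : Prop :=
  ∀ Z : 𝔤, ∀ x ∈ W, D.π Z x ∈ W

/-- `W` is a `π(𝔤)`-irreducible subspace of `𝔳`: it is nonzero and invariant, and its only invariant
subspaces are zero and itself. -/
structure IsIrreducibleSubspace (D : DataSet 𝔤 𝔳) (W : Submodule ℝ 𝔳) : Prop where
  ne_bot : W ≠ ⊥
  invariant : D.IsInvariantSubspace W
  eq_bot_or_eq : ∀ U : Submodule ℝ 𝔳, U ≤ W → D.IsInvariantSubspace U → U = ⊥ ∨ U = W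

end DataSet

open Module

/-! The index one of the sum metric is already used up by `𝔳`, so the metric on `𝔤` is positive
definite. An orthonormal basis `e i` of `𝔤` then gives a Casimir operator `C = ∑ π(e i)²`, symmetric
and commuting with `π(𝔤)`. For lightlike `y`, `⟨Cy, y⟩ = -∑ ⟨π(e i)y, π(e i)y⟩`. Each `π(e i)y` is
orthogonal to `y`, so its square is nonnegative, and it vanishes only for multiples of `y`. Hence
`⟨Cy, y⟩ ≤ 0`, with equality exactly when `y` spans an invariant line.

Such a `y` exists (`exists_invariant_lightlike`): otherwise some irreducible subspace contains a
timelike vector, hence a lightlike one, and there Schur's lemma forces equality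
(`IsIrreducibleSubspace.metricV_casimir_eq_zero`).

The weight of the line kills brackets, so its metric dual `Z` is central, and `π(Z)` has a nonzero
eigenvalue `l` on the line (`exists_mem_center`). By skewness `-l` is an eigenvalue too. Its
eigenspace is totally isotropic, hence a line, and it is invariant because `Z` is central. The two
lines span the Lorentzian plane. Its orthogonal complement is positive definite and splits into
irreducibles, on which Schur's lemma determines the action of the center. -/

theorem mem_soAlg_iff {V : Type*} [AddCommGroup V] [Module ℝ V] {B : LinearMap.BilinForm ℝ V}
    {A : Module.End ℝ V} : A ∈ soAlg B ↔ ∀ x y, B (A x) y = -B x (A y) := by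
  change A ∈ B.skewAdjointSubmodule ↔ _
  rw [LinearMap.mem_skewAdjointSubmodule]
  simp [LinearMap.IsSkewAdjoint, LinearMap.IsAdjointPair]

/-! ### Metrics of index at most one and lightlike vectors -/

section Bilin

variable {V : Type*} [AddCommGroup V] [Module ℝ V] {B : LinearMap.BilinForm ℝ V}

theorem IsMetric.exists_apply_ne_zero (hB : IsMetric B) {x : V} (hx : x ≠ 0) : ∃ y, B x y ≠ 0 := by
  by_contra! h
  exact hx (hB.nondegenerate.1 x h)

theorem IsRiemannian.exists_orthonormal_basis [FiniteDimensional ℝ V] (hB : IsRiemannian B) :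
    ∃ e : Basis (Fin (finrank ℝ V)) ℝ V, ∀ i j, B (e i) (e j) = if i = j then 1 else 0 := by
  obtain ⟨v, hv⟩ := LinearMap.BilinForm.exists_orthogonal_basis (B := B)
    ((LinearMap.BilinForm.isSymm_iff (B := B)).1 hB.symm)
  have hpos (i) : 0 < B (v i) (v i) := hB.pos _ (v.ne_zero i)
  refine ⟨v.unitsSMul fun i ↦ Units.mk0 (√(B (v i) (v i)))⁻¹
    (inv_ne_zero (Real.sqrt_ne_zero'.2 (hpos i))), fun i j ↦ ?_⟩
  simp only [Basis.unitsSMul_apply, Units.smul_mk0, map_smul, LinearMap.smul_apply, smul_eq_mul]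
  split_ifs with h
  · subst h
    have := Real.mul_self_sqrt (hpos i).le
    have := (Real.sqrt_ne_zero'.2 (hpos i))
    field_simp
    nlinarith
  · have : B (v i) (v j) = 0 := hv h
    simp [this]

/-- An orthogonal pair of timelike vectors forces the index to be at least two. -/
theorem two_le_sigNeg [FiniteDimensional ℝ V] (hB : B.IsSymm) {x y : V} (hx : B x x < 0)
    (hy : B y y < 0) (hxy : B x y = 0) : 2 ≤ sigNeg B.toQuadraticMap := by
  have hyx : B y x = 0 := by rw [hB.eq]; exact hxy
  have hli : LinearIndependent ℝ ![x, y] := by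
    rw [LinearIndependent.pair_iff]
    intro s t h
    have h1 : B x (s • x + t • y) = 0 := by rw [h, map_zero]
    have h2 : B y (s • x + t • y) = 0 := by rw [h, map_zero]
    simp only [map_add, map_smul, hxy, hyx, smul_eq_mul, mul_zero, add_zero, zero_add,
      mul_eq_zero, hx.ne, hy.ne, or_false] at h1 h2
    exact ⟨h1, h2⟩
  have hneg : ((-B.toQuadraticMap).restrict (Submodule.span ℝ (Set.range ![x, y]))).PosDef := by
    rintro ⟨z, hz⟩ hz0
    have hz0 : z ≠ 0 := by simpa using hz0
    simp only [Matrix.range_cons, Matrix.range_empty, Set.union_empty, Set.singleton_union] at hz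
    obtain ⟨s, t, rfl⟩ := Submodule.mem_span_pair.1 hz
    have key : B (s • x + t • y) (s • x + t • y) = s ^ 2 * B x x + t ^ 2 * B y y := by
      simp only [map_add, map_smul, LinearMap.add_apply, LinearMap.smul_apply, hxy, hyx,
        smul_eq_mul]
      ring
    simp only [QuadraticMap.restrict_apply, neg_apply,
      LinearMap.BilinMap.toQuadraticMap_apply, key]
    by_cases hs : s = 0
    · have ht : t ≠ 0 := by rintro rfl; simp [hs] at hz0
      have : 0 < t ^ 2 := by positivity
      nlinarith [sq_nonneg s]
    · have : 0 < s ^ 2 := by positivity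
      nlinarith [sq_nonneg t]
  simpa [finrank_span_eq_card hli] using le_sigNeg_of_negDef _ hneg

theorem exists_apply_self_neg [FiniteDimensional ℝ V] (h : 0 < sigNeg B.toQuadraticMap) :
    ∃ x, B x x < 0 := by
  obtain ⟨W, hW, hneg⟩ := exists_finrank_eq_sigNeg_and_negDef B.toQuadraticMap
  have : Nontrivial W := Module.nontrivial_of_finrank_pos (R := ℝ) (by omega)
  obtain ⟨w, hw⟩ := exists_ne (0 : W)
  have := hneg w hw
  simp only [QuadraticMap.restrict_apply, neg_apply,
      LinearMap.BilinMap.toQuadraticMap_apply] at this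
  exact ⟨w, by linarith⟩

/-- A metric that is not positive definite has a timelike vector. -/
theorem IsMetric.exists_apply_self_neg (hB : IsMetric B) {x : V} (hx : x ≠ 0) (h : B x x ≤ 0) :
    ∃ y, B y y < 0 := by
  obtain h | h := h.lt_or_eq
  · exact ⟨x, h⟩
  obtain ⟨z, hz⟩ := hB.exists_apply_ne_zero hx
  -- As `x` is null, the square of `z + t • x` is affine in `t`; this `t` makes it `-1`.
  refine ⟨z + (-(B z z + 1) / (2 * B x z)) • x, ?_⟩
  have : B z x = B x z := hB.symm.eq _ _
  simp only [map_add, map_smul, LinearMap.add_apply, LinearMap.smul_apply, h, this, smul_eq_mul]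
  have : -(B z z + 1) / (2 * B x z) * B x z = -(B z z + 1) / 2 := by field_simp
  linarith

variable [FiniteDimensional ℝ V]

/-- A timelike vector orthogonal to `x` would raise the index to two. A null `y` orthogonal to `x`
would produce one: nondegeneracy gives a vector pairing nontrivially with `y`, and after projection
along `x` a shift by a multiple of `y` makes its square `-1`. -/
theorem IsLorentzian.apply_self_pos (hB : IsLorentzian B) {x y : V} (hx : B x x < 0)
    (hxy : B x y = 0) (hy : y ≠ 0) : 0 < B y y := by
  by_contra! h
  have hno (z : V) (hz : B x z = 0) : 0 ≤ B z z := by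
    by_contra! hz'
    have := two_le_sigNeg hB.symm hx hz' hz
    have := hB.sigNeg_eq_one
    omega
  have h0 : B y y = 0 := le_antisymm h (hno y hxy)
  obtain ⟨z, hz⟩ := hB.exists_apply_ne_zero hy
  have hyx : B y x = 0 := by rw [hB.symm.eq]; exact hxy
  set w := z - (B x z / B x x) • x with hw
  have hxw : B x w = 0 := by
    simp only [hw, map_sub, map_smul, smul_eq_mul]
    field_simp [hx.ne]
    simp
  have hyw : B y w ≠ 0 := by simpa [hw, hyx] using hz
  have hwy : B w y = B y w := hB.symm.eq _ _
  have := hno (w + (-(B w w + 1) / (2 * B y w)) • y) (by simp [hxw, hxy])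
  have e : B (w + (-(B w w + 1) / (2 * B y w)) • y) (w + (-(B w w + 1) / (2 * B y w)) • y) = -1 := by
    simp only [map_add, map_smul, LinearMap.add_apply, LinearMap.smul_apply, h0, hwy, smul_eq_mul]
    field_simp
    ring
  linarith

theorem IsLorentzian.apply_ne_zero (hB : IsLorentzian B) {x y : V} (hx : B x x < 0)
    (hy : IsLightlike B y) : B x y ≠ 0 := fun h ↦
  (hB.apply_self_pos hx h hy.1).ne' hy.2

/-- A vector orthogonal to a lightlike vector is a multiple of it or spacelike. -/
theorem IsLorentzian.exists_smul_or_pos (hB : IsLorentzian B) {y z : V} (hy : IsLightlike B y)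
    (hyz : B y z = 0) : (∃ c : ℝ, z = c • y) ∨ 0 < B z z := by
  obtain ⟨x, hx⟩ := _root_.exists_apply_self_neg (B := B) (by rw [hB.sigNeg_eq_one]; exact one_pos)
  have hxy := hB.apply_ne_zero hx hy
  have hzy : B z y = 0 := by rw [hB.symm.eq]; exact hyz
  -- This translate of `z` is orthogonal to the timelike `x` and has the same square as `z`.
  by_cases h : z - (B x z / B x y) • y = 0
  · exact .inl ⟨_, sub_eq_zero.1 h⟩
  · right
    have := hB.apply_self_pos hx (by simp; field_simp; simp) h
    simpa [hyz, hzy, hy.2] using this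

theorem IsLorentzian.apply_self_nonneg (hB : IsLorentzian B) {y z : V} (hy : IsLightlike B y)
    (hyz : B y z = 0) : 0 ≤ B z z := by
  obtain ⟨c, rfl⟩ | h := hB.exists_smul_or_pos hy hyz
  · simp [hy.2]
  · exact h.le

theorem IsLorentzian.exists_smul (hB : IsLorentzian B) {y z : V} (hy : IsLightlike B y)
    (hyz : B y z = 0) (hz : B z z = 0) : ∃ c : ℝ, z = c • y :=
  (hB.exists_smul_or_pos hy hyz).resolve_right hz.not_gt

end Bilin

/-! ### Real quadratic factors of an endomorphism -/

section Polynomial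

variable {V : Type*} [AddCommGroup V] [Module ℝ V]

theorem Polynomial.aeval_apply_mem_of_invariant {T : End ℝ V} {W : Submodule ℝ V}
    (hW : ∀ x ∈ W, T x ∈ W) (p : Polynomial ℝ) {x : V} (hx : x ∈ W) :
    Polynomial.aeval T p x ∈ W := by
  induction p using Polynomial.induction_on' with
  | add p q hp hq => simpa using W.add_mem hp hq
  | monomial n a =>
    rw [Polynomial.aeval_monomial]
    refine W.smul_mem _ ?_
    induction n with
    | zero => simpa
    | succ n ih => simpa [pow_succ'] using hW _ ih

/-- An invariant subspace contains an eigenvector, or a vector on which a translate of the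
endomorphism squares to a scalar. -/
theorem exists_sub_smul_sq_apply_eq_smul [FiniteDimensional ℝ V] (T : End ℝ V)
    {W : Submodule ℝ V} (hW : ∀ x ∈ W, T x ∈ W) (hW0 : W ≠ ⊥) :
    ∃ μ γ : ℝ, ∃ x ∈ W, x ≠ 0 ∧ (T - μ • 1) ((T - μ • 1) x) = γ • x := by
  -- Irreducible factors are stripped off an annihilating polynomial until one of them kills a
  -- nonzero vector of `W`; over `ℝ` it has degree at most two.
  have key (p : Polynomial ℝ) : p ≠ 0 → (∃ x ∈ W, x ≠ 0 ∧ Polynomial.aeval T p x = 0) →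
      ∃ q : Polynomial ℝ, Irreducible q ∧ ∃ x ∈ W, x ≠ 0 ∧ Polynomial.aeval T q x = 0 := by
    induction p using WfDvdMonoid.induction_on_irreducible with
    | zero => intro h; exact absurd rfl h
    | unit u hu =>
      rintro - ⟨x, -, hx0, hx⟩
      obtain ⟨v, hv⟩ := hu.exists_left_inv
      refine absurd ?_ hx0
      have : Polynomial.aeval T (v * u) x = 0 := by simp [hx]
      simpa [hv] using this
    | mul a i ha hi ih =>
      rintro - ⟨x, hxW, hx0, hx⟩
      by_cases h : Polynomial.aeval T a x = 0
      · exact ih ha ⟨x, hxW, hx0, h⟩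
      · exact ⟨i, hi, _, Polynomial.aeval_apply_mem_of_invariant hW a hxW, h, by simpa using hx⟩
  obtain ⟨x, hxW, hx0⟩ := W.exists_mem_ne_zero_of_ne_bot hW0
  obtain ⟨q, hq, x, hxW, hx0, hx⟩ := key (minpoly ℝ T) (minpoly.ne_zero (Algebra.IsIntegral.isIntegral T))
    ⟨x, hxW, hx0, by simp⟩
  have hq2 := Polynomial.eq_quadratic_of_degree_le_two hq.degree_le_two
  generalize q.coeff 2 = a, q.coeff 1 = b, q.coeff 0 = c at hq2
  have h : a • T (T x) + b • T x + c • x = 0 := by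
    simpa [hq2, pow_two, Algebra.algebraMap_eq_smul_one] using hx
  by_cases ha : a = 0
  · by_cases hb : b = 0
    · have hc : c ≠ 0 := by rintro rfl; exact hq.ne_zero (by simp [hq2, ha, hb])
      simp [ha, hb, hc, hx0] at h
    · refine ⟨-c / b, 0, x, hxW, hx0, ?_⟩
      have : (T - (-c / b) • 1) x = 0 := by
        rw [ha, zero_smul, zero_add] at h
        have : T x = (-c / b) • x := by
          rw [← smul_right_injective V hb |>.eq_iff]
          simp only [smul_smul, mul_div_cancel₀ _ hb, neg_smul]
          exact eq_neg_of_add_eq_zero_left h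
        simp [this]
      simp [this]
  -- Completing the square.
  · refine ⟨-b / (2 * a), (-b / (2 * a)) ^ 2 - c / a, x, hxW, hx0, ?_⟩
    have : T (T x) = (-b / a) • T x + (-c / a) • x := by
      rw [← smul_right_injective V ha |>.eq_iff]
      simp only [smul_smul, mul_div_cancel₀ _ ha, smul_add, neg_smul]
      rw [← sub_eq_zero, ← h]; abel
    simp only [LinearMap.sub_apply, LinearMap.smul_apply, End.one_apply, map_sub, map_smul, this]
    match_scalars <;> field_simp <;> ring

end Polynomial

/-! ### Invariance, Schur's lemma and the Casimir operator -/

namespace DataSet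

variable {𝔤 𝔳 : Type*} [LieRing 𝔤] [LieAlgebra ℝ 𝔤] [AddCommGroup 𝔳] [Module ℝ 𝔳]
  (D : DataSet 𝔤 𝔳)

theorem metricV_π (Z : 𝔤) (x y : 𝔳) : D.metricV (D.π Z x) y = -D.metricV x (D.π Z y) :=
  mem_soAlg_iff.1 (D.π_mem_so Z) x y

theorem metricV_comm (x y : 𝔳) : D.metricV x y = D.metricV y x := D.isMetric_metricV.symm.eq x y

theorem metricG_comm (x y : 𝔤) : D.metricG x y = D.metricG y x := D.isMetric_metricG.symm.eq x y

theorem metricV_π_self (Z : 𝔤) (x : 𝔳) : D.metricV x (D.π Z x) = 0 := by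
  have := D.metricV_π Z x x
  rw [D.metricV_comm] at this
  linarith

theorem metricG_lie (X Y Z : 𝔤) : D.metricG ⁅X, Y⁆ Z = -D.metricG Y ⁅X, Z⁆ :=
  mem_soAlg_iff.1 (D.ad_mem_so X) Y Z

theorem eq_zero_of_π_eq_zero {x : 𝔳} (h : ∀ Z, D.π Z x = 0) : x = 0 := by
  have : x ∈ ⨅ Z : 𝔤, LinearMap.ker (D.π Z) := by simpa using h
  rwa [D.iInf_ker_eq_bot] at this

theorem π_lie_apply (X Y : 𝔤) (x : 𝔳) :
    D.π ⁅X, Y⁆ x = D.π X (D.π Y x) - D.π Y (D.π X x) := by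
  rw [LieHom.map_lie, LieRing.of_associative_ring_bracket]; rfl

theorem isRiemannian_metricG [FiniteDimensional ℝ 𝔤] [FiniteDimensional ℝ 𝔳]
    (hD : D.IsLorentzianDataSet) (hV : IsLorentzian D.metricV) : IsRiemannian D.metricG where
  symm := D.isMetric_metricG.symm
  pos Z hZ := by
    by_contra! h
    obtain ⟨X, hX⟩ := D.isMetric_metricG.exists_apply_self_neg hZ h
    obtain ⟨x, hx⟩ := exists_apply_self_neg (B := D.metricV) (by rw [hV.sigNeg_eq_one]; exact one_pos)
    have := two_le_sigNeg hD.symm (x := (X, 0)) (y := (0, x)) (by simpa [metricN_apply])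
      (by simpa [metricN_apply]) (by simp [metricN_apply])
    have := hD.sigNeg_eq_one
    omega

variable {D}

theorem IsInvariantSubspace.inf {U W : Submodule ℝ 𝔳} (hU : D.IsInvariantSubspace U)
    (hW : D.IsInvariantSubspace W) : D.IsInvariantSubspace (U ⊓ W) :=
  fun Z x hx ↦ ⟨hU Z x hx.1, hW Z x hx.2⟩

theorem IsInvariantSubspace.orthogonal {U : Submodule ℝ 𝔳} (hU : D.IsInvariantSubspace U) :
    D.IsInvariantSubspace (D.metricV.orthogonal U) := by
  intro Z x hx u hu
  have := hx _ (hU Z u hu)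
  rw [D.metricV_π] at this
  exact neg_eq_zero.1 this

theorem isInvariantSubspace_ker {T : End ℝ 𝔳} (hT : ∀ Z x, T (D.π Z x) = D.π Z (T x)) :
    D.IsInvariantSubspace (LinearMap.ker T) := by
  intro Z x hx
  rw [LinearMap.mem_ker] at hx ⊢
  rw [hT, hx, map_zero]

/-- Schur's lemma for a commuting endomorphism of the ambient space. -/
theorem IsIrreducibleSubspace.le_ker {W : Submodule ℝ 𝔳} (hW : D.IsIrreducibleSubspace W)
    {T : End ℝ 𝔳} (hT : ∀ Z x, T (D.π Z x) = D.π Z (T x)) {x : 𝔳} (hx : x ∈ W) (hx0 : x ≠ 0)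
    (hTx : T x = 0) : ∀ y ∈ W, T y = 0 := by
  have h := hW.eq_bot_or_eq (W ⊓ LinearMap.ker T) inf_le_left
    (hW.invariant.inf (isInvariantSubspace_ker hT))
  rcases h with h | h
  · exact absurd (show x ∈ W ⊓ LinearMap.ker T from ⟨hx, hTx⟩) (by simpa [h])
  · intro y hy
    rw [← h] at hy
    exact hy.2

variable (D)

section Casimir

variable {ι : Type*} [Fintype ι]

/-- The Casimir operator of the representation with respect to a family in the Lie algebra. -/
noncomputable def casimir (e : ι → 𝔤) : End ℝ 𝔳 := ∑ i, D.π (e i) * D.π (e i)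

theorem casimir_apply (e : ι → 𝔤) (x : 𝔳) : D.casimir e x = ∑ i, D.π (e i) (D.π (e i) x) := by
  simp [casimir]

theorem metricV_casimir (e : ι → 𝔤) (x y : 𝔳) :
    D.metricV (D.casimir e x) y = -∑ i, D.metricV (D.π (e i) x) (D.π (e i) y) := by
  simp [casimir_apply, metricV_π]

theorem metricV_casimir_comm (e : ι → 𝔤) (x y : 𝔳) :
    D.metricV (D.casimir e x) y = D.metricV x (D.casimir e y) := by
  rw [D.metricV_comm x, metricV_casimir, metricV_casimir]
  simp only [D.metricV_comm (D.π _ x)]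

/-- In an orthonormal basis the matrix of `ad Z` is antisymmetric, whereas the products of two `π(e
i)` enter the commutator symmetrically, so the double sum equals its own negative. -/
theorem casimir_π [DecidableEq ι] (e : Basis ι ℝ 𝔤)
    (he : ∀ i j, D.metricG (e i) (e j) = if i = j then 1 else 0) (Z : 𝔤) (x : 𝔳) :
    D.casimir e (D.π Z x) = D.π Z (D.casimir e x) := by
  have hrepr (X : 𝔤) : X = ∑ j, D.metricG X (e j) • e j := by
    have (j : ι) : D.metricG X (e j) = e.repr X j := by
      conv_lhs => rw [← e.sum_repr X]
      simp [he, -Basis.sum_repr]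
    simp only [this, e.sum_repr]
  have hanti (i j : ι) : D.metricG ⁅Z, e i⁆ (e j) = -D.metricG ⁅Z, e j⁆ (e i) := by
    rw [metricG_lie, metricG_comm]
  have hlie (i : ι) (y : 𝔳) : D.π Z (D.π (e i) y) - D.π (e i) (D.π Z y)
      = ∑ j, D.metricG ⁅Z, e i⁆ (e j) • D.π (e j) y := by
    rw [← π_lie_apply]
    conv_lhs => rw [hrepr ⁅Z, e i⁆]
    simp
  have hsum : D.π Z (D.casimir e x) - D.casimir e (D.π Z x) =
      ∑ i, ∑ j, D.metricG ⁅Z, e i⁆ (e j) •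
        (D.π (e j) (D.π (e i) x) + D.π (e i) (D.π (e j) x)) := by
    simp only [casimir_apply, map_sum, ← Finset.sum_sub_distrib]
    refine Finset.sum_congr rfl fun i _ ↦ ?_
    simp only [smul_add, Finset.sum_add_distrib, ← hlie]
    have := congrArg (D.π (e i)) (hlie i x)
    simp only [map_sum, map_smul, map_sub] at this
    rw [← this]
    abel
  have hneg : D.π Z (D.casimir e x) - D.casimir e (D.π Z x) =
      -(D.π Z (D.casimir e x) - D.casimir e (D.π Z x)) := by
    conv_lhs => rw [hsum, Finset.sum_comm]
    rw [hsum, ← Finset.sum_neg_distrib]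
    refine Finset.sum_congr rfl fun i _ ↦ ?_
    rw [← Finset.sum_neg_distrib]
    refine Finset.sum_congr rfl fun j _ ↦ ?_
    rw [hanti j i, neg_smul, add_comm]
  rw [eq_neg_iff_add_eq_zero, ← two_smul ℝ, smul_eq_zero] at hneg
  exact (sub_eq_zero.1 (hneg.resolve_left two_ne_zero)).symm

end Casimir

end DataSet

/-! ### Existence of an invariant lightlike line -/

namespace DataSet

variable {𝔤 𝔳 : Type*} [LieRing 𝔤] [LieAlgebra ℝ 𝔤] [AddCommGroup 𝔳] [Module ℝ 𝔳]
  {D : DataSet 𝔤 𝔳}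

theorem exists_isIrreducibleSubspace_le [FiniteDimensional ℝ 𝔳] {W : Submodule ℝ 𝔳} (hW0 : W ≠ ⊥)
    (hW : D.IsInvariantSubspace W) : ∃ U ≤ W, D.IsIrreducibleSubspace U := by
  obtain ⟨U, ⟨hUW, hU0, hU⟩, hmin⟩ := (wellFounded_lt (α := Submodule ℝ 𝔳)).has_min
    {U | U ≤ W ∧ U ≠ ⊥ ∧ D.IsInvariantSubspace U} ⟨W, le_rfl, hW0, hW⟩
  refine ⟨U, hUW, hU0, hU, fun T hTU hT ↦ ?_⟩
  by_contra! h
  exact hmin T ⟨hTU.trans hUW, h.1, hT⟩ (lt_of_le_of_ne hTU h.2)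

/-- A nonzero invariant subspace meeting its orthogonal complement gives an invariant lightlike
line. -/
theorem exists_isLightlike_of_mem_orthogonal [FiniteDimensional ℝ 𝔳]
    (hV : IsLorentzian D.metricV) {U : Submodule ℝ 𝔳} (hU : D.IsInvariantSubspace U) {u : 𝔳}
    (hu0 : u ≠ 0) (hu : u ∈ U) (hu' : u ∈ D.metricV.orthogonal U) :
    IsLightlike D.metricV u ∧ ∀ Z, ∃ c : ℝ, D.π Z u = c • u := by
  have h : IsLightlike D.metricV u := ⟨hu0, hu' u hu⟩
  refine ⟨h, fun Z ↦ hV.exists_smul h (D.metricV_π_self Z u) ?_⟩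
  exact hU.orthogonal Z u hu' _ (hU Z u hu)

/-- Without invariant lightlike lines, every invariant subspace is complemented by its orthogonal.
An invariant subspace minimal among those with a timelike vector cannot split: one of the two
components of a timelike vector would be timelike. -/
theorem exists_irreducible_timelike [FiniteDimensional ℝ 𝔳] (hV : IsLorentzian D.metricV)
    (hno : ¬ ∃ e, IsLightlike D.metricV e ∧ ∀ Z, ∃ c : ℝ, D.π Z e = c • e) :
    ∃ W, D.IsIrreducibleSubspace W ∧ ∃ x ∈ W, D.metricV x x < 0 := by
  obtain ⟨x₀, hx₀⟩ := exists_apply_self_neg (B := D.metricV)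
    (by rw [hV.sigNeg_eq_one]; exact one_pos)
  obtain ⟨W, ⟨hW, x, hxW, hx⟩, hmin⟩ := (wellFounded_lt (α := Submodule ℝ 𝔳)).has_min
    {U | D.IsInvariantSubspace U ∧ ∃ x ∈ U, D.metricV x x < 0}
    ⟨⊤, fun _ _ _ ↦ trivial, x₀, trivial, hx₀⟩
  refine ⟨W, ⟨?_, hW, fun U hUW hU ↦ ?_⟩, x, hxW, hx⟩
  · rintro rfl
    rw [(Submodule.mem_bot ℝ).1 hxW] at hx
    simp at hx
  have hdisj : Disjoint U (D.metricV.orthogonal U) := by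
    rw [Submodule.disjoint_def]
    intro u hu hu'
    by_contra hu0
    exact hno ⟨u, exists_isLightlike_of_mem_orthogonal hV hU hu0 hu hu'⟩
  by_contra! h
  have hcompl := (LinearMap.BilinForm.isCompl_orthogonal_iff_disjoint
    D.isMetric_metricV.symm.isRefl).2 hdisj
  obtain ⟨u, hu, v, hv, rfl⟩ := Submodule.mem_sup.1
    (show x ∈ U ⊔ D.metricV.orthogonal U by rw [hcompl.sup_eq_top]; trivial)
  have huv : D.metricV u v = 0 := hv u hu
  have hvu : D.metricV v u = 0 := by rwa [D.metricV_comm]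
  simp only [map_add, LinearMap.add_apply, huv, hvu, add_zero, zero_add] at hx
  have hUneg : 0 ≤ D.metricV u u := by
    by_contra! hneg
    exact hmin U ⟨hU, u, hu, hneg⟩ (lt_of_le_of_ne hUW h.2)
  have hvW : v ∈ W := by simpa using W.sub_mem hxW (hUW hu)
  have hle : W ≤ W ⊓ D.metricV.orthogonal U := by
    by_contra hnle
    exact hmin (W ⊓ D.metricV.orthogonal U) ⟨hW.inf hU.orthogonal, v, ⟨hvW, hv⟩, by linarith⟩
      (lt_of_le_not_ge inf_le_left hnle)
  exact h.1 (le_bot_iff.1 (hdisj le_rfl (hUW.trans (hle.trans inf_le_right))))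

/-- An invariant subspace with a timelike vector contains a lightlike one. -/
theorem IsInvariantSubspace.exists_isLightlike [FiniteDimensional ℝ 𝔳]
    (hV : IsLorentzian D.metricV) {W : Submodule ℝ 𝔳} (hW : D.IsInvariantSubspace W) {x : 𝔳}
    (hxW : x ∈ W) (hx : D.metricV x x < 0) : ∃ y ∈ W, IsLightlike D.metricV y := by
  have hx0 : x ≠ 0 := by rintro rfl; simp at hx
  obtain ⟨Z, hZ⟩ : ∃ Z, D.π Z x ≠ 0 := by
    by_contra! h
    exact hx0 (D.eq_zero_of_π_eq_zero h)
  have hxz := D.metricV_π_self Z x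
  have hzW := hW Z x hxW
  generalize D.π Z x = z at *
  have hz := hV.apply_self_pos hx hxz hZ
  have hzx : D.metricV z x = 0 := by rwa [D.metricV_comm]
  have hs := Real.sq_sqrt (div_nonneg hz.le (neg_pos.2 hx).le)
  set s := √(D.metricV z z / -D.metricV x x)
  -- `z` is spacelike and orthogonal to `x`; `s` balances the two squares.
  refine ⟨z + s • x, W.add_mem hzW (W.smul_mem s hxW), fun h ↦ hz.ne' ?_, ?_⟩
  · simpa [hzx] using congrArg (D.metricV z) h
  · simp only [map_add, map_smul, LinearMap.add_apply, LinearMap.smul_apply, hxz, hzx, smul_eq_mul]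
    rw [eq_div_iff (neg_pos.2 hx).ne'] at hs
    linarith

section Casimir

variable [FiniteDimensional ℝ 𝔳] {ι : Type*} [Fintype ι]

theorem metricV_casimir_nonpos (hV : IsLorentzian D.metricV) (e : ι → 𝔤) {y : 𝔳}
    (hy : IsLightlike D.metricV y) : D.metricV (D.casimir e y) y ≤ 0 := by
  rw [metricV_casimir, neg_nonpos]
  exact Finset.sum_nonneg fun i _ ↦ hV.apply_self_nonneg hy (D.metricV_π_self _ y)

theorem exists_smul_of_metricV_casimir (hV : IsLorentzian D.metricV) (e : Basis ι ℝ 𝔤) {y : 𝔳}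
    (hy : IsLightlike D.metricV y) (h : D.metricV (D.casimir e y) y = 0) (Z : 𝔤) :
    ∃ c : ℝ, D.π Z y = c • y := by
  rw [metricV_casimir, neg_eq_zero, Finset.sum_eq_zero_iff_of_nonneg
    fun i _ ↦ hV.apply_self_nonneg hy (D.metricV_π_self _ y)] at h
  have (i : ι) : ∃ c : ℝ, D.π (e i) y = c • y :=
    hV.exists_smul hy (D.metricV_π_self _ y) (h i (Finset.mem_univ i))
  choose c hc using this
  refine ⟨∑ i, e.repr Z i * c i, ?_⟩
  conv_lhs => rw [← e.sum_repr Z]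
  simp [-Basis.sum_repr, hc, Finset.sum_smul, mul_smul]

/-- On an irreducible subspace the quadratic form of the Casimir operator vanishes on lightlike
vectors. -/
theorem IsIrreducibleSubspace.metricV_casimir_eq_zero [DecidableEq ι] (hV : IsLorentzian D.metricV)
    (e : Basis ι ℝ 𝔤) (he : ∀ i j, D.metricG (e i) (e j) = if i = j then 1 else 0)
    {W : Submodule ℝ 𝔳} (hW : D.IsIrreducibleSubspace W) {y : 𝔳} (hyW : y ∈ W)
    (hy : IsLightlike D.metricV y) : D.metricV (D.casimir e y) y = 0 := by
  have hC := D.casimir_π e he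
  have hCW (x) (hx : x ∈ W) : D.casimir e x ∈ W := by
    rw [casimir_apply]
    exact W.sum_mem fun i _ ↦ hW.invariant _ _ (hW.invariant _ _ hx)
  obtain ⟨μ, γ, x, hxW, hx0, hx⟩ := exists_sub_smul_sq_apply_eq_smul (D.casimir e) hCW hW.ne_bot
  set S := D.casimir e - μ • 1 with hS
  have hSapply (z) : S z = D.casimir e z - μ • z := by simp [hS]
  have hSπ (Z : 𝔤) (z : 𝔳) : S (D.π Z z) = D.π Z (S z) := by simp [hSapply, hC]
  have hSW (z) (hz : z ∈ W) : S z ∈ W := by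
    rw [hSapply]; exact W.sub_mem (hCW z hz) (W.smul_mem μ hz)
  have hSsymm (u v : 𝔳) : D.metricV (S u) v = D.metricV u (S v) := by
    simp [hSapply, metricV_casimir_comm]
  have hSC {z : 𝔳} (hz : D.metricV z z = 0) : D.metricV (D.casimir e z) z = D.metricV (S z) z := by
    simp [hSapply, hz]
  -- The relation at `x` spreads over `W` by Schur's lemma.
  have hSS : ∀ z ∈ W, S (S z) = γ • z := by
    have := hW.le_ker (T := S * S - γ • 1) (fun Z z ↦ by simp [hSπ]) hxW hx0 (by simp [hx])
    intro z hz
    simpa [sub_eq_zero] using this z hz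
  rw [hSC hy.2]
  obtain hγ | hγ := le_or_gt 0 γ
  · obtain ⟨s, hs⟩ : ∃ s : ℝ, s * s = γ := ⟨√γ, Real.mul_self_sqrt hγ⟩
    -- From `(S - s)(S + s) = 0` on `W`, either `S y = -s • y`, or `S = s` on all of `W`; both make
    -- `⟨Sy, y⟩` a multiple of `⟨y, y⟩ = 0`.
    by_cases h : S y + s • y = 0
    · simp [eq_neg_of_add_eq_zero_left h, hy.2]
    · have := hW.le_ker (T := S - s • 1) (fun Z z ↦ by simp [hSπ])
        (W.add_mem (hSW y hyW) (W.smul_mem s hyW)) h (by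
          simp only [LinearMap.sub_apply, map_add, map_smul, hSS y hyW, ← hs, mul_smul,
            LinearMap.smul_apply, End.one_apply]
          rw [smul_sub]
          abel) y hyW
      have : S y = s • y := by simpa [sub_eq_zero] using this
      simp [this, hy.2]
  · apply le_antisymm
    · rw [← hSC hy.2]
      exact metricV_casimir_nonpos hV e hy
    · by_cases h0 : S y = 0
      · simp [h0]
      -- Now `S y` is lightlike too, and the Casimir inequality at `S y` reads `γ⟨y, Sy⟩ ≤ 0`; since
      -- `γ < 0`, it reverses the inequality at `y`.
      have hnull : D.metricV (S y) (S y) = 0 := by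
        rw [hSsymm, hSS y hyW, map_smul, hy.2, smul_zero]
      have := metricV_casimir_nonpos hV e ⟨h0, hnull⟩
      rw [hSC hnull, hSS y hyW, map_smul, LinearMap.smul_apply, smul_eq_mul, ← hSsymm] at this
      nlinarith

end Casimir

variable [FiniteDimensional ℝ 𝔤] [FiniteDimensional ℝ 𝔳]

theorem exists_invariant_lightlike (hD : D.IsLorentzianDataSet) (hV : IsLorentzian D.metricV) :
    ∃ e, IsLightlike D.metricV e ∧ ∀ Z, ∃ c : ℝ, D.π Z e = c • e := by
  by_contra hno
  obtain ⟨W, hW, x, hxW, hx⟩ := exists_irreducible_timelike hV hno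
  obtain ⟨y, hyW, hy⟩ := hW.invariant.exists_isLightlike hV hxW hx
  obtain ⟨e, he⟩ := (D.isRiemannian_metricG hD hV).exists_orthonormal_basis
  exact hno ⟨y, hy, exists_smul_of_metricV_casimir hV e hy
    (hW.metricV_casimir_eq_zero hV e he hyW hy)⟩

/-- The weight of an invariant lightlike line is represented by a central element. -/
theorem exists_mem_center (hD : D.IsLorentzianDataSet) (hV : IsLorentzian D.metricV) {e : 𝔳}
    (he0 : e ≠ 0) (he : ∀ Z, ∃ c : ℝ, D.π Z e = c • e) :
    ∃ Z ∈ LieAlgebra.center ℝ 𝔤, ∃ c : ℝ, c ≠ 0 ∧ D.π Z e = c • e := by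
  choose c hc using he
  let l : 𝔤 →ₗ[ℝ] ℝ :=
    { toFun := c
      map_add' := fun X Y ↦ smul_left_injective ℝ he0 (by simp [add_smul, ← hc])
      map_smul' := fun a X ↦ smul_left_injective ℝ he0 (by simp [mul_smul, ← hc]) }
  have hl (X : 𝔤) : l X = c X := rfl
  have hlie (X Y : 𝔤) : c ⁅X, Y⁆ = 0 := by
    refine smul_left_injective ℝ he0 ?_
    simp only [← hc, π_lie_apply, zero_smul]
    simp only [hc, map_smul, smul_smul, mul_comm, sub_self]
  -- By ad-invariance, the metric dual of a functional vanishing on brackets is central, and its own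
  -- weight is `⟨Z, Z⟩`.
  obtain ⟨Z, hZ⟩ : ∃ Z, ∀ X, D.metricG Z X = c X :=
    ⟨(D.metricG.toDual D.isMetric_metricG.nondegenerate).symm l, fun X ↦ by
      rw [LinearMap.BilinForm.apply_toDual_symm_apply, hl]⟩
  refine ⟨Z, ?_, c Z, ?_, hc Z⟩
  · rw [LieModule.mem_maxTrivSubmodule]
    intro X
    by_contra h
    obtain ⟨Y, hY⟩ := D.isMetric_metricG.exists_apply_ne_zero h
    exact hY (by rw [metricG_lie, hZ, hlie, neg_zero])
  · rw [← hZ]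
    refine ((D.isRiemannian_metricG hD hV).pos Z ?_).ne'
    rintro rfl
    exact he0 (D.eq_zero_of_π_eq_zero fun X ↦ by rw [hc, ← hZ]; simp)

end DataSet

/-! ### Restricted metrics and orthogonal complex structures -/

section Bilin

variable {V : Type*} [AddCommGroup V] [Module ℝ V] {B : LinearMap.BilinForm ℝ V}

theorem IsLorentzian.restrict [FiniteDimensional ℝ V] (hB : IsLorentzian B) {W : Submodule ℝ V}
    {x : V} (hxW : x ∈ W) (hx : B x x < 0) : IsLorentzian (B.restrict W) where
  symm := hB.symm.restrict W
  nondegenerate := by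
    have h (u : W) (hu : B x u = 0) (hu' : B u u = 0) : u = 0 := by
      by_contra hu0
      exact (hB.apply_self_pos hx hu (by simpa using hu0)).ne' hu'
    refine ⟨fun u hu ↦ h u ?_ (hu u), fun u hu ↦ h u (hu ⟨x, hxW⟩) (hu u)⟩
    rw [hB.symm.eq]
    exact hu ⟨x, hxW⟩
  sigNeg_eq_one := by
    apply le_antisymm
    · obtain ⟨U, hU, hneg⟩ := exists_finrank_eq_sigNeg_and_negDef (B.restrict W).toQuadraticMap
      rw [← hU, ← Submodule.finrank_map_subtype_eq W U, ← hB.sigNeg_eq_one]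
      refine le_sigNeg_of_negDef _ ?_
      rintro ⟨_, u, hu, rfl⟩ hu0
      exact hneg ⟨u, hu⟩ (by simpa using hu0)
    · have hx0 : (⟨x, hxW⟩ : W) ≠ 0 := by
        intro h
        have : x = 0 := congrArg Subtype.val h
        simp [this] at hx
      rw [← finrank_span_singleton (K := ℝ) hx0]
      refine le_sigNeg_of_negDef _ ?_
      rintro ⟨u, hu⟩ hu0
      obtain ⟨c, rfl⟩ := Submodule.mem_span_singleton.1 hu
      have hc : c ≠ 0 := by rintro rfl; simp at hu0
      have : (0 : ℝ) < c * (c * -B x x) := by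
        rw [← mul_assoc]
        exact mul_pos (mul_self_pos.2 hc) (neg_pos.2 hx)
      simpa using this

theorem IsRiemannian.exists_skew_sq_eq_neg_one [FiniteDimensional ℝ V] (hB : IsRiemannian B)
    (h : Even (finrank ℝ V)) : ∃ J ∈ soAlg B, J * J = -1 := by
  obtain ⟨m, hm⟩ := h
  obtain ⟨e, he⟩ := hB.exists_orthonormal_basis
  let b := e.reindex ((finCongr hm).trans finSumFinEquiv.symm)
  have hb (i j) : B (b i) (b j) = if i = j then 1 else 0 := by simp [b, he]
  let J : End ℝ V := b.constr ℝ (Sum.elim (fun i ↦ b (.inr i)) fun i ↦ -b (.inl i))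
  have hl (i) : J (b (.inl i)) = b (.inr i) := by simp [J]
  have hr (i) : J (b (.inr i)) = -b (.inl i) := by simp [J]
  refine ⟨J, mem_soAlg_iff.2 fun x y ↦ ?_, b.ext ?_⟩
  · have : B.comp J LinearMap.id = -B.comp LinearMap.id J := by
      refine LinearMap.BilinForm.ext_basis b ?_
      rintro (i | i) (j | j) <;> simp [hl, hr, hb]
    exact congrArg (fun C : LinearMap.BilinForm ℝ V ↦ C x y) this
  · rintro (i | i) <;> simp [hl, hr]

end Bilin

/-! ### The center on irreducible summands and the lightlike pair -/

namespace DataSet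

variable {𝔤 𝔳 : Type*} [LieRing 𝔤] [LieAlgebra ℝ 𝔤] [AddCommGroup 𝔳] [Module ℝ 𝔳]
  {D : DataSet 𝔤 𝔳}

theorem restrict_mem_so {W : Submodule ℝ 𝔳} (hW : D.IsInvariantSubspace W) (Z : 𝔤) :
    (D.π Z).restrict (hW Z) ∈ soAlg (D.metricV.restrict W) :=
  mem_soAlg_iff.2 fun x y ↦ D.metricV_π Z x y

theorem π_comm_of_mem_center {Z : 𝔤} (hZ : Z ∈ LieAlgebra.center ℝ 𝔤) (X : 𝔤) (x : 𝔳) :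
    D.π Z (D.π X x) = D.π X (D.π Z x) := by
  have h : ⁅X, Z⁆ = 0 := (LieModule.mem_maxTrivSubmodule ..).1 hZ X
  have := D.π_lie_apply X Z x
  rw [h, map_zero, LinearMap.zero_apply] at this
  exact (sub_eq_zero.1 this.symm).symm

theorem isIrreducibleSubspace_span_singleton {e : 𝔳} (he0 : e ≠ 0)
    (he : ∀ Z, ∃ c : ℝ, D.π Z e = c • e) : D.IsIrreducibleSubspace (ℝ ∙ e) where
  ne_bot := by simpa using he0
  invariant Z x hx := by
    obtain ⟨s, rfl⟩ := Submodule.mem_span_singleton.1 hx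
    obtain ⟨c, hc⟩ := he Z
    rw [map_smul, hc]
    exact Submodule.smul_mem _ _ (Submodule.smul_mem _ _ (Submodule.mem_span_singleton_self e))
  eq_bot_or_eq U hU _ := (nonzero_span_atom e he0).le_iff.1 hU

/-- Schur's lemma for commuting symmetric endomorphisms. -/
theorem IsIrreducibleSubspace.exists_eq_smul [FiniteDimensional ℝ 𝔳] {W : Submodule ℝ 𝔳}
    (hW : D.IsIrreducibleSubspace W) (hpos : IsRiemannian (D.metricV.restrict W)) {T : End ℝ 𝔳}
    (hT : ∀ Z x, T (D.π Z x) = D.π Z (T x)) (hTW : ∀ x ∈ W, T x ∈ W)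
    (hsymm : ∀ x y, D.metricV (T x) y = D.metricV x (T y)) :
    ∃ κ : ℝ, ∀ x ∈ W, T x = κ • x := by
  obtain ⟨μ, γ, x, hxW, hx0, hx⟩ := exists_sub_smul_sq_apply_eq_smul T hTW hW.ne_bot
  set S := T - μ • 1 with hS
  have hSapply (z) : S z = T z - μ • z := by simp [hS]
  have hSπ (Z : 𝔤) (z : 𝔳) : S (D.π Z z) = D.π Z (S z) := by simp [hSapply, hT]
  have hSW (z) (hz : z ∈ W) : S z ∈ W := by
    rw [hSapply]; exact W.sub_mem (hTW z hz) (W.smul_mem μ hz)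
  have hscalar {s : ℝ} {z : 𝔳} (hz : z ∈ W) (hz0 : z ≠ 0) (h : S z = s • z) :
      ∃ κ : ℝ, ∀ x ∈ W, T x = κ • x := by
    have := hW.le_ker (T := S - s • 1) (fun Z z ↦ by simp [hSπ]) hz hz0 (by simp [h])
    refine ⟨s + μ, fun x hx ↦ ?_⟩
    have := this x hx
    simp only [LinearMap.sub_apply, LinearMap.smul_apply, End.one_apply, hSapply] at this
    rw [sub_sub, sub_eq_zero] at this
    rw [this, add_smul, add_comm]
  -- Symmetry of `S` gives `⟨Sx, Sx⟩ = γ⟨x, x⟩`, and both squares are nonnegative.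
  have hγ : 0 ≤ γ := by
    have h : D.metricV (S x) (S x) = γ * D.metricV x x := by
      rw [← smul_eq_mul, ← LinearMap.smul_apply, ← map_smul, ← hx]
      simp [hSapply, hsymm]
    have hx1 : 0 < D.metricV x x := hpos.pos ⟨x, hxW⟩ (by simpa using hx0)
    have hx2 : 0 ≤ D.metricV (S x) (S x) := by
      by_cases h0 : S x = 0
      · simp [h0]
      · exact (hpos.pos ⟨S x, hSW x hxW⟩ (by simpa using h0)).le
    rw [h] at hx2
    exact nonneg_of_mul_nonneg_left hx2 hx1
  obtain ⟨s, hs⟩ : ∃ s : ℝ, s * s = γ := ⟨√γ, Real.mul_self_sqrt hγ⟩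
  by_cases h : S x + s • x = 0
  · exact hscalar (s := -s) hxW hx0 (by rw [neg_smul]; exact eq_neg_of_add_eq_zero_left h)
  · refine hscalar (s := s) (W.add_mem (hSW x hxW) (W.smul_mem s hxW)) h ?_
    rw [map_add, map_smul, hx, ← hs, smul_add, mul_smul, add_comm]

/-- A product of two commuting skew maps is symmetric, so for central `Z` and `X` the map `π(Z)π(X)`
is a scalar on `W`. If `Z` acts nontrivially, `π(Z)²` is a negative scalar, `J` is `π(Z)`
normalized, and every `π(X)` is a multiple of it. If the center acts by zero, any skew complex
structure serves in even dimension. -/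
theorem IsIrreducibleSubspace.center_action [FiniteDimensional ℝ 𝔳] {W : Submodule ℝ 𝔳}
    (hW : D.IsIrreducibleSubspace W) (hpos : IsRiemannian (D.metricV.restrict W)) :
    (∃ J ∈ soAlg (D.metricV.restrict W), J * J = -1 ∧
      ∀ Z ∈ LieAlgebra.center ℝ 𝔤, ∃ c : ℝ, ∀ x : W, D.π Z x = c • (J x : 𝔳)) ∨
    (Odd (finrank ℝ W) ∧ ∀ Z ∈ LieAlgebra.center ℝ 𝔤, ∀ x ∈ W, D.π Z x = 0) := by
  by_cases htriv : ∀ Z ∈ LieAlgebra.center ℝ 𝔤, ∀ x ∈ W, D.π Z x = 0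
  · obtain hev | hodd := Nat.even_or_odd (finrank ℝ W)
    · obtain ⟨J, hJ, hJ2⟩ := hpos.exists_skew_sq_eq_neg_one hev
      exact .inl ⟨J, hJ, hJ2, fun Z hZ ↦ ⟨0, fun x ↦ by simp [htriv Z hZ x x.2]⟩⟩
    · exact .inr ⟨hodd, htriv⟩
  left
  push Not at htriv
  obtain ⟨Z, hZ, x, hxW, hx⟩ := htriv
  have hscalar {X : 𝔤} (hX : X ∈ LieAlgebra.center ℝ 𝔤) :
      ∃ κ : ℝ, ∀ x ∈ W, D.π Z (D.π X x) = κ • x :=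
    hW.exists_eq_smul hpos (T := D.π Z * D.π X)
      (fun Y y ↦ by
        rw [End.mul_apply, π_comm_of_mem_center hX, π_comm_of_mem_center hZ, End.mul_apply])
      (fun y hy ↦ hW.invariant _ _ (hW.invariant _ _ hy))
      (fun y z ↦ by
        rw [End.mul_apply, metricV_π, metricV_π, neg_neg, End.mul_apply, π_comm_of_mem_center hZ])
  obtain ⟨κ, hκ⟩ := hscalar hZ
  have hκneg : κ < 0 := by
    have h : D.metricV (D.π Z x) (D.π Z x) = -(κ * D.metricV x x) := by
      rw [metricV_π, hκ x hxW, map_smul, smul_eq_mul]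
    have h1 : 0 < D.metricV (D.π Z x) (D.π Z x) :=
      hpos.pos ⟨_, hW.invariant Z x hxW⟩ (by simpa using hx)
    have h2 : 0 < D.metricV x x := hpos.pos ⟨x, hxW⟩ (by
      intro h; exact hx (by rw [show x = 0 from congrArg Subtype.val h, map_zero]))
    nlinarith
  have hs := Real.mul_self_sqrt (neg_pos.2 hκneg).le
  have hs0 := Real.sqrt_ne_zero'.2 (neg_pos.2 hκneg)
  set s := √(-κ)
  refine ⟨s⁻¹ • (D.π Z).restrict (hW.invariant Z),
    (soAlg _).smul_mem _ (restrict_mem_so hW.invariant Z), ?_, fun X hX ↦ ?_⟩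
  · ext ⟨y, hy⟩
    have : s⁻¹ * (s⁻¹ * κ) = -1 := by
      rw [← neg_eq_iff_eq_neg.2 hs.symm.symm]
      field_simp
    simp [hκ y hy, smul_smul, mul_assoc, this]
  · obtain ⟨κ', hκ'⟩ := hscalar hX
    refine ⟨κ' / κ * s, fun y ↦ ?_⟩
    have h1 : κ • D.π X y = κ' • D.π Z y := by
      rw [← hκ _ (hW.invariant X y y.2), hκ' y y.2, map_smul]
    have h2 : D.π X y = (κ' / κ) • D.π Z y := by
      rw [← smul_right_injective 𝔳 hκneg.ne |>.eq_iff]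
      simp only [smul_smul, mul_div_cancel₀ _ hκneg.ne, h1]
    simp [h2, smul_smul, hs0]

/-- An invariant positive definite subspace is an orthogonal sum of irreducible ones. -/
theorem IsInvariantSubspace.exists_decomposition [FiniteDimensional ℝ 𝔳] {U : Submodule ℝ 𝔳}
    (hU : D.IsInvariantSubspace U) (hpos : ∀ x ∈ U, x ≠ 0 → 0 < D.metricV x x) :
    ∃ (k : ℕ) (V : Fin k → Submodule ℝ 𝔳), (∀ i, V i ≤ U) ∧ (∀ i, D.IsIrreducibleSubspace (V i)) ∧
      (∀ i j, i ≠ j → ∀ x ∈ V i, ∀ y ∈ V j, D.metricV x y = 0) ∧ ⨆ i, V i = U := by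
  induction U using WellFoundedLT.induction with
  | ind U ih =>
  by_cases hU0 : U = ⊥
  · exact ⟨0, Fin.elim0, fun i ↦ i.elim0, fun i ↦ i.elim0, fun i ↦ i.elim0, by simp [hU0]⟩
  obtain ⟨M, hMU, hM⟩ := exists_isIrreducibleSubspace_le hU0 hU
  have hdisj : Disjoint M (D.metricV.orthogonal M) := by
    rw [Submodule.disjoint_def]
    intro u hu hu'
    by_contra hu0
    exact (hpos u (hMU hu) hu0).ne' (hu' u hu)
  have hsup : M ⊔ U ⊓ D.metricV.orthogonal M = U := by
    rw [inf_comm, ← sup_inf_assoc_of_le _ hMU, ((LinearMap.BilinForm.isCompl_orthogonal_iff_disjoint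
      D.isMetric_metricV.symm.isRefl).2 hdisj).sup_eq_top, top_inf_eq]
  have hlt : U ⊓ D.metricV.orthogonal M < U := by
    refine lt_of_le_not_ge inf_le_left fun h ↦ hM.ne_bot ?_
    exact le_bot_iff.1 (hdisj le_rfl (hMU.trans (h.trans inf_le_right)))
  obtain ⟨k, V, hVU, hV, hortho, hVsup⟩ := ih _ hlt (hU.inf hM.invariant.orthogonal)
    fun x hx ↦ hpos x hx.1
  refine ⟨k + 1, Fin.cons M V, ?_, ?_, ?_, ?_⟩
  · exact Fin.cases hMU fun i ↦ (hVU i).trans inf_le_left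
  · exact Fin.cases hM hV
  · intro i j hij x hx y hy
    induction i using Fin.cases with
    | zero =>
      induction j using Fin.cases with
      | zero => exact absurd rfl hij
      | succ j => exact (hVU j hy).2 x hx
    | succ i =>
      induction j using Fin.cases with
      | zero => rw [D.metricV_comm]; exact (hVU i hx).2 y hy
      | succ j => exact hortho i j (fun h ↦ hij (congrArg _ h)) x hx y hy
  · rw [← hsup, ← hVsup]
    refine le_antisymm (iSup_le (Fin.cases le_sup_left fun i ↦ ?_))
      (sup_le (le_iSup (Fin.cons M V : Fin (k + 1) → Submodule ℝ 𝔳) 0) (iSup_le fun i ↦ ?_))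
    · exact le_iSup (Fin.cons M V : Fin (k + 1) → Submodule ℝ 𝔳) i.succ
    · exact (le_iSup V i).trans le_sup_right

variable [FiniteDimensional ℝ 𝔤] [FiniteDimensional ℝ 𝔳]

theorem exists_lightlike_pair (hD : D.IsLorentzianDataSet) (hV : IsLorentzian D.metricV) :
    ∃ e f, IsLightlike D.metricV e ∧ IsLightlike D.metricV f ∧ D.metricV e f ≠ 0 ∧
      ∃ c : 𝔤 → ℝ, (∀ Z, D.π Z e = c Z • e) ∧ (∀ Z, D.π Z f = -c Z • f) ∧ ∃ Z, c Z ≠ 0 := by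
  obtain ⟨e, he, hinv⟩ := exists_invariant_lightlike hD hV
  obtain ⟨Z, hZ, l, hl, hZe⟩ := exists_mem_center hD hV he.1 hinv
  obtain ⟨f, hf0, hf⟩ : ∃ f ≠ 0, D.π Z f = -l • f := by
    have hni : ¬ Function.Injective (D.π Z - l • 1 : End ℝ 𝔳) := by
      intro h
      exact he.1 (h (by simp [hZe]))
    have hns : ¬ Function.Surjective (D.π Z - l • 1 : End ℝ 𝔳) :=
      fun h ↦ hni (LinearMap.injective_iff_surjective.2 h)
    -- By skewness `-(π Z + l)` is the adjoint of `π Z - l`, so surjectivity of the former would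
    -- make the latter injective.
    have hni' : ¬ Function.Injective (D.π Z + l • 1 : End ℝ 𝔳) := by
      intro h
      refine hni ((injective_iff_map_eq_zero _).2 fun x hx ↦ ?_)
      by_contra hx0
      obtain ⟨y, hy⟩ := D.isMetric_metricV.exists_apply_ne_zero hx0
      obtain ⟨z, rfl⟩ := LinearMap.injective_iff_surjective.1 h y
      have : D.metricV ((D.π Z - l • 1 : End ℝ 𝔳) x) z = 0 := by rw [hx]; simp
      simp only [LinearMap.sub_apply, LinearMap.smul_apply, End.one_apply, map_sub, map_smul,
        metricV_π] at this
      simp only [LinearMap.add_apply, LinearMap.smul_apply, End.one_apply, map_add, map_smul] at hy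
      exact hy (by linarith)
    rw [injective_iff_map_eq_zero] at hni'
    push Not at hni'
    obtain ⟨f, hf, hf0⟩ := hni'
    refine ⟨f, hf0, ?_⟩
    rw [neg_smul]
    exact eq_neg_of_add_eq_zero_left (by simpa using hf)
  have hiso {x y : 𝔳} (hx : D.π Z x = -l • x) (hy : D.π Z y = -l • y) : D.metricV x y = 0 := by
    have := D.metricV_π Z x y
    rw [hx, hy, map_smul, map_smul, LinearMap.smul_apply, smul_eq_mul] at this
    have : l * D.metricV x y = 0 := by linarith
    exact (mul_eq_zero.1 this).resolve_left hl
  have hflight : IsLightlike D.metricV f := ⟨hf0, hiso hf hf⟩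
  have hef : D.metricV e f ≠ 0 := by
    intro h
    obtain ⟨c, rfl⟩ := hV.exists_smul he h hflight.2
    rw [map_smul, hZe, smul_comm c l, ← sub_eq_zero, ← sub_smul] at hf
    have := (smul_eq_zero.1 hf).resolve_right hf0
    exact hl (by linarith)
  choose c hc using hinv
  refine ⟨e, f, he, hflight, hef, c, hc, fun X ↦ ?_, Z, ?_⟩
  · obtain ⟨d, hd⟩ : ∃ d : ℝ, D.π X f = d • f := by
      -- Since `Z` is central, `π X` preserves the `-l` eigenspace, whose vectors are null and
      -- mutually orthogonal, hence proportional.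
      have hXf : D.π Z (D.π X f) = -l • D.π X f := by
        rw [π_comm_of_mem_center hZ, hf, map_smul]
      exact hV.exists_smul hflight (hiso hf hXf) (hiso hXf hXf)
    have := D.metricV_π X e f
    rw [hc, hd, map_smul, map_smul, LinearMap.smul_apply, smul_eq_mul, smul_eq_mul] at this
    have : (c X + d) * D.metricV e f = 0 := by linarith
    rw [hd, eq_neg_of_add_eq_zero_right ((mul_eq_zero.1 this).resolve_right hef)]
  · intro h
    rw [hc, h, zero_smul] at hZe
    exact (smul_ne_zero hl he.1) hZe.symm

end DataSet

/-! ### Assembling the decomposition -/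

theorem mainTheorem3 {𝔤 𝔳 : Type*} [LieRing 𝔤] [LieAlgebra ℝ 𝔤] [FiniteDimensional ℝ 𝔤]
    [AddCommGroup 𝔳] [Module ℝ 𝔳] [FiniteDimensional ℝ 𝔳] (D : DataSet 𝔤 𝔳)
    (hD : D.IsLorentzianDataSet) (hV : IsLorentzian D.metricV) :
    ∃ (k : ℕ) (V : Fin (k + 1) → Submodule ℝ 𝔳),
      -- orthogonal decomposition into invariant subspaces
      DirectSum.IsInternal V ∧
      (∀ i j, i ≠ j → ∀ x ∈ V i, ∀ y ∈ V j, D.metricV x y = 0) ∧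
      (∀ i, D.IsInvariantSubspace (V i)) ∧
      -- the summands other than the first one are Riemannian and irreducible
      (∀ i, i ≠ 0 → IsRiemannian (D.metricV.restrict (V i)) ∧ D.IsIrreducibleSubspace (V i)) ∧
      -- the first summand is a Lorentzian plane, the sum of two invariant lightlike lines
      IsLorentzian (D.metricV.restrict (V 0)) ∧
      Module.finrank ℝ (V 0) = 2 ∧
      (∃ w₀ w₁ : 𝔳, IsLightlike D.metricV w₀ ∧ IsLightlike D.metricV w₁ ∧
        D.IsIrreducibleSubspace (ℝ ∙ w₀) ∧ D.IsIrreducibleSubspace (ℝ ∙ w₁) ∧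
        Disjoint (ℝ ∙ w₀) (ℝ ∙ w₁) ∧ (ℝ ∙ w₀) ⊔ (ℝ ∙ w₁) = V 0) ∧
      -- the action of the center on the Riemannian summands
      (∀ i, i ≠ 0 →
        (∃ J ∈ soAlg (D.metricV.restrict (V i)), J * J = -1 ∧
          ∀ Z ∈ LieAlgebra.center ℝ 𝔤, ∃ c : ℝ, ∀ x : V i, D.π Z x = c • (J x : 𝔳)) ∨
        (Odd (Module.finrank ℝ (V i)) ∧
          ∀ Z ∈ LieAlgebra.center ℝ 𝔤, ∀ x ∈ V i, D.π Z x = 0)) ∧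
      -- the action of the center on the Lorentzian plane
      (∃ J ∈ soAlg (D.metricV.restrict (V 0)), J * J = 1 ∧
        ∀ Z ∈ LieAlgebra.center ℝ 𝔤, ∃ c : ℝ, ∀ x : V 0, D.π Z x = c • (J x : 𝔳)) := by
  obtain ⟨e, f, he, hf, hef, c, hce, hcf, Z₀, hZ₀⟩ := D.exists_lightlike_pair hD hV
  have hline_e := DataSet.isIrreducibleSubspace_span_singleton he.1 fun Z ↦ ⟨_, hce Z⟩
  have hline_f := DataSet.isIrreducibleSubspace_span_singleton hf.1 fun Z ↦ ⟨_, hcf Z⟩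
  have hdisj : Disjoint (ℝ ∙ e) (ℝ ∙ f) := by
    rw [Submodule.disjoint_span_singleton' hf.1, Submodule.mem_span_singleton]
    rintro ⟨s, rfl⟩
    simp [he.2] at hef
  set P : Submodule ℝ 𝔳 := (ℝ ∙ e) ⊔ (ℝ ∙ f)
  have heP : e ∈ P := Submodule.mem_sup_left (Submodule.mem_span_singleton_self e)
  have hfP : f ∈ P := Submodule.mem_sup_right (Submodule.mem_span_singleton_self f)
  have hmem (x) (hx : x ∈ P) : ∃ a b : ℝ, a • e + b • f = x := by
    obtain ⟨u, hu, v, hv, rfl⟩ := Submodule.mem_sup.1 hx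
    obtain ⟨a, rfl⟩ := Submodule.mem_span_singleton.1 hu
    obtain ⟨b, rfl⟩ := Submodule.mem_span_singleton.1 hv
    exact ⟨a, b, rfl⟩
  have hPinv : D.IsInvariantSubspace P := by
    intro Z x hx
    obtain ⟨u, hu, v, hv, rfl⟩ := Submodule.mem_sup.1 hx
    rw [map_add]
    exact P.add_mem (Submodule.mem_sup_left (hline_e.invariant Z u hu))
      (Submodule.mem_sup_right (hline_f.invariant Z v hv))
  obtain ⟨t, htP, ht⟩ : ∃ t ∈ P, D.metricV t t < 0 := by
    -- This vector has square `-2`.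
    refine ⟨e - (D.metricV e f)⁻¹ • f, P.sub_mem heP (P.smul_mem _ hfP), ?_⟩
    have := D.metricV_comm f e
    simp [he.2, hf.2, this, hef]
  have hPlor := hV.restrict htP ht
  have hPact : ∃ J ∈ soAlg (D.metricV.restrict P), J * J = 1 ∧
      ∀ Z ∈ LieAlgebra.center ℝ 𝔤, ∃ c : ℝ, ∀ x : P, D.π Z x = c • (J x : 𝔳) := by
    -- This `J` fixes `e` and negates `f`, so every `π(Z)` acts on the plane as `c Z • J`.
    refine ⟨(c Z₀)⁻¹ • (D.π Z₀).restrict (hPinv Z₀),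
      (soAlg _).smul_mem _ (DataSet.restrict_mem_so hPinv Z₀), ?_, fun Z _ ↦ ⟨c Z, ?_⟩⟩
    · refine LinearMap.ext fun ⟨x, hx⟩ ↦ Subtype.ext ?_
      obtain ⟨a, b, rfl⟩ := hmem x hx
      simp [hce, hcf, smul_smul, hZ₀, mul_left_comm _ _ (c Z₀)]
    · rintro ⟨x, hx⟩
      obtain ⟨a, b, rfl⟩ := hmem x hx
      simp [hce, hcf, smul_smul, hZ₀, mul_comm]
  have hPdisj : Disjoint P (D.metricV.orthogonal P) := by
    rw [Submodule.disjoint_def]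
    intro u hu hu'
    by_contra hu0
    exact (hV.apply_self_pos ht (hu' t htP) hu0).ne' (hu' u hu)
  have hPsup : P ⊔ D.metricV.orthogonal P = ⊤ :=
    ((LinearMap.BilinForm.isCompl_orthogonal_iff_disjoint
      D.isMetric_metricV.symm.isRefl).2 hPdisj).sup_eq_top
  obtain ⟨k, V, hVP, hVirr, hVortho, hVsup⟩ := hPinv.orthogonal.exists_decomposition
    fun x hx hx0 ↦ hV.apply_self_pos ht (hx t htP) hx0
  have hVpos (i) : IsRiemannian (D.metricV.restrict (V i)) :=
    ⟨D.isMetric_metricV.symm.restrict _, fun x hx0 ↦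
      hV.apply_self_pos ht (hVP i x.2 t htP) (by simpa using hx0)⟩
  have hortho : ∀ i j : Fin (k + 1), i ≠ j → ∀ x ∈ (Fin.cons P V : Fin (k + 1) → Submodule ℝ 𝔳) i,
      ∀ y ∈ (Fin.cons P V : Fin (k + 1) → Submodule ℝ 𝔳) j, D.metricV x y = 0 := by
    intro i j hij x hx y hy
    induction i using Fin.cases with
    | zero =>
      induction j using Fin.cases with
      | zero => exact absurd rfl hij
      | succ j => exact hVP j hy x hx
    | succ i =>
      induction j using Fin.cases with
      | zero => rw [D.metricV_comm]; exact hVP i hx y hy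
      | succ j => exact hVortho i j (fun h ↦ hij (congrArg _ h)) x hx y hy
  have hnondeg : ∀ i : Fin (k + 1), ∀ x ∈ (Fin.cons P V : Fin (k + 1) → Submodule ℝ 𝔳) i,
      (∀ y ∈ (Fin.cons P V : Fin (k + 1) → Submodule ℝ 𝔳) i, D.metricV y x = 0) → x = 0 := by
    intro i x hx h
    induction i using Fin.cases with
    | zero => exact Submodule.disjoint_def.1 hPdisj x hx h
    | succ i =>
      by_contra hx0
      exact ((hVpos i).pos ⟨x, hx⟩ fun h0 ↦ hx0 (congrArg Subtype.val h0)).ne' (h x hx)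
  refine ⟨k, Fin.cons P V, ?_, hortho, Fin.cases hPinv fun i ↦ (hVirr i).invariant, ?_, hPlor, ?_,
    ⟨e, f, he, hf, hline_e, hline_f, hdisj, rfl⟩, ?_, hPact⟩
  · refine DirectSum.isInternal_submodule_of_iSupIndep_of_iSup_eq_top (fun i ↦ ?_) ?_
    -- A vector of one summand lying in the span of the others is orthogonal to its own summand, on
    -- which the metric is nondegenerate.
    · rw [Submodule.disjoint_def]
      intro x hx hx'
      refine hnondeg i x hx fun y hy ↦ ?_
      have hle : ⨆ j, ⨆ (_ : j ≠ i), (Fin.cons P V : Fin (k + 1) → Submodule ℝ 𝔳) j ≤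
          LinearMap.ker (D.metricV y) :=
        iSup₂_le fun j hj z hz ↦ hortho i j hj.symm y hy z hz
      exact hle hx'
    · rw [eq_top_iff, ← hPsup, ← hVsup]
      exact sup_le (le_iSup (Fin.cons P V : Fin (k + 1) → Submodule ℝ 𝔳) 0)
        (iSup_le fun i ↦ le_iSup (Fin.cons P V : Fin (k + 1) → Submodule ℝ 𝔳) i.succ)
  · exact Fin.cases (fun h ↦ absurd rfl h) fun i _ ↦ ⟨hVpos i, hVirr i⟩
  · change Module.finrank ℝ P = 2
    have := Submodule.finrank_sup_add_finrank_inf_eq (ℝ ∙ e) (ℝ ∙ f)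
    rw [hdisj.eq_bot, finrank_bot, finrank_span_singleton he.1, finrank_span_singleton hf.1] at this
    exact this
  · exact Fin.cases (fun h ↦ absurd rfl h) fun i _ ↦ (hVirr i).center_action (hVpos i)
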